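/- Let $K$ be a field. For a residually finite group $H$, an exhausting normal chain in $H$ is a nested sequence $B_0\supseteq B_1\supseteq\cdots$ of normal subgroups of finite index in $H$ with $\bigcap_n B_n=\{1\}$. A group $H$ is called \emph{$K$-slow above dimension $1$} if it is residually finite and for every exhausting normal chain $(B_n)$ in $H$ and every $j\ge 2$, $$\lim_{n\to\infty}\frac{\dim_K H_j(B_n,K)}{[H:B_n]}=0,$$ where $\dim_K H_j(B_n,K)\in\{0,1,2,\dots,\infty\}$ and the limit is taken in $[0,\infty]$. It is called \emph{$K$-slow} if, in addition, this limit is $0$ for $j=1$ as well (for every exhausting normal chain). A graph of groups $\mathcal G$ consists of a non-empty connected graph with vertex set $V$ and edge set $E$ (loops and multiple edges allowed), in which each edge $e$ has an initial vertex $\iota(e)$ and a terminal vertex $\tau(e)$, together with vertex groups $G_v$ $(v\in V)$, edge groups $G_e$ $(e\in E)$ and monomorphisms $G_e\to G_{\iota(e)}$, $G_e\to G_{\tau(e)}$. It is finite if $V$ and $E$ are finite. Its fundamental group $\pi_1\mathcal G$ is the fundamental group in the sense of Bass and Serre. \textbf{Proposition.} Let $\mathcal G$ be a finite graph of groups and let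 $G\cong\pi_1\mathcal G$ be residually finite. If all of the edge groups of $\mathcal G$ are $K$-slow and all of the vertex groups of $\mathcal G$ are $K$-slow above dimension $1$, then $G$ is $K$-slow above dimension $1$. -/

import Mathlib

open Filter Topology
open scoped ENNReal

universe u v w

/-! ### Homological slowness -/

/-- A nested sequence `B 0 ⊇ B 1 ⊇ ⋯` of finite-index normal subgroups of `G` whose intersection
is trivial. -/
structure IsExhaustingNormalChain {G : Type u} [Group G] (B : ℕ → Subgroup G) : Prop where
  antitone : Antitone B
  normal : ∀ n, (B n).Normal
  finiteIndex : ∀ n, (B n).FiniteIndex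
  iInf_eq_bot : ⨅ n, B n = ⊥

/-- `dim_K H_j(G, K)` for trivial coefficients `K`, with value `⊤` if it is infinite. -/
noncomputable def homologyDim (K : Type u) [Field K] (G : Type u) [Group G] (j : ℕ) : ℕ∞ :=
  Cardinal.toENat (Module.rank K (groupHomology (Rep.trivial K G K) j))

/-- For every exhausting normal chain `(B n)` of `G`, the ratio `dim_K H_j(B n, K) / [G : B n]`
tends to `0`. The ratio lives in `[0, ∞]`, so that an infinite-dimensional homology group
contributes `∞`. -/
def HomologyGradientVanishes (K : Type u) [Field K] (G : Type u) [Group G] (j : ℕ) : Prop :=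
  ∀ B : ℕ → Subgroup G, IsExhaustingNormalChain B →
    Tendsto (fun n => ((homologyDim K (B n) j : ℕ∞) : ℝ≥0∞) / ((B n).index : ℝ≥0∞))
      atTop (𝓝 0)

/-- `G` is `K`-slow above dimension `1`. -/
structure IsKSlowAboveDimOne (K : Type u) [Field K] (G : Type u) [Group G] : Prop where
  residuallyFinite : Group.ResiduallyFinite G
  vanishes : ∀ j, 2 ≤ j → HomologyGradientVanishes K G j

/-- `G` is `K`-slow. -/
structure IsKSlow (K : Type u) [Field K] (G : Type u) [Group G] : Prop
    extends IsKSlowAboveDimOne K G where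
  vanishes_one : HomologyGradientVanishes K G 1

/-! ### Graphs of groups and their fundamental groups -/

/-- A graph of groups on the vertex set `V` and the set `E` of (arbitrarily oriented) edges:
the underlying graph is connected, loops and multiple edges are allowed, and each edge group is
embedded in the groups of the initial and the terminal vertex of the edge. -/
structure GraphOfGroups (V : Type v) (E : Type w) where
  /-- initial vertex of an edge -/
  init : E → V
  /-- terminal vertex of an edge -/
  term : E → V
  /-- the graph is non-empty -/
  nonempty : Nonempty V
  /-- the equivalence relation generated by `init e ∼ term e` has only one class -/
  connected : ∀ a b : V, Relation.EqvGen (fun x y => ∃ e, init e = x ∧ term e = y) a b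
  vertexGroup : V → Type u
  [vertexGroupStr : ∀ x, Group (vertexGroup x)]
  edgeGroup : E → Type u
  [edgeGroupStr : ∀ e, Group (edgeGroup e)]
  initHom : ∀ e, edgeGroup e →* vertexGroup (init e)
  termHom : ∀ e, edgeGroup e →* vertexGroup (term e)
  initHom_injective : ∀ e, Function.Injective (initHom e)
  termHom_injective : ∀ e, Function.Injective (termHom e)

namespace GraphOfGroups

attribute [instance] vertexGroupStr edgeGroupStr

variable {V : Type v} {E : Type w} (𝒢 : GraphOfGroups.{u} V E)

/-- The free product of all vertex groups and of the free group on the edges. -/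
abbrev FreeProd : Type (max u v w) :=
  Monoid.Coprod (Monoid.CoprodI 𝒢.vertexGroup) (FreeGroup E)

/-- The relators of Serre's path group: `ι_e(a) t_e = t_e τ_e(a)` for each edge `e` and each `a`
in its edge group. -/
def relators : Set 𝒢.FreeProd :=
  {r | ∃ (e : E) (a : 𝒢.edgeGroup e),
    r = (Monoid.Coprod.inl (Monoid.CoprodI.of (𝒢.initHom e a)) *
          Monoid.Coprod.inr (FreeGroup.of e)) *
        (Monoid.Coprod.inr (FreeGroup.of e) *
          Monoid.Coprod.inl (Monoid.CoprodI.of (𝒢.termHom e a)))⁻¹}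

/-- Serre's path group `F(𝒢)`. -/
abbrev PathGroup : Type (max u v w) :=
  𝒢.FreeProd ⧸ Subgroup.normalClosure 𝒢.relators

/-- The canonical homomorphism from a vertex group to the path group. -/
def ofVertex (x : V) : 𝒢.vertexGroup x →* 𝒢.PathGroup :=
  (QuotientGroup.mk' (Subgroup.normalClosure 𝒢.relators)).comp
    (Monoid.Coprod.inl.comp Monoid.CoprodI.of)

/-- The generator `t_e` of the path group. -/
def stable (e : E) : 𝒢.PathGroup :=
  QuotientGroup.mk' (Subgroup.normalClosure 𝒢.relators) (Monoid.Coprod.inr (FreeGroup.of e))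

/-- `𝒢.IsPathElement x y p`: the element `p` of the path group is of the form
`g₀ t_{e₁}^{±1} g₁ ⋯ t_{eₙ}^{±1} gₙ`, where `e₁^{±1}, …, eₙ^{±1}` is an edge path from `x` to `y`
and each `gᵢ` belongs to the group of the vertex that this path visits after `i` steps. -/
inductive IsPathElement : V → V → 𝒢.PathGroup → Prop
  | vertex (x : V) (g : 𝒢.vertexGroup x) : IsPathElement x x (𝒢.ofVertex x g)
  | edge (e : E) : IsPathElement (𝒢.init e) (𝒢.term e) (𝒢.stable e)
  | edgeInv (e : E) : IsPathElement (𝒢.term e) (𝒢.init e) (𝒢.stable e)⁻¹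
  | mul {x y z : V} {p q : 𝒢.PathGroup} :
      IsPathElement x y p → IsPathElement y z q → IsPathElement x z (p * q)

variable {𝒢} in
theorem IsPathElement.inv {x y : V} {p : 𝒢.PathGroup} (h : 𝒢.IsPathElement x y p) :
    𝒢.IsPathElement y x p⁻¹ := by
  induction h with
  | vertex x g =>
    rw [← map_inv]
    exact .vertex x g⁻¹
  | edge e => exact .edgeInv e
  | edgeInv e =>
    rw [inv_inv]
    exact .edge e
  | mul _ _ h₁ h₂ =>
    rw [mul_inv_rev]
    exact .mul h₂ h₁

/-- The fundamental group `π₁(𝒢, x₀)` of a graph of groups: the elements of the path group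
that are carried by closed edge paths based at `x₀`. -/
def fundamentalGroup (x₀ : V) : Subgroup 𝒢.PathGroup where
  carrier := {p | 𝒢.IsPathElement x₀ x₀ p}
  mul_mem' := fun hp hq => .mul hp hq
  one_mem' := by
    have h := IsPathElement.vertex (𝒢 := 𝒢) x₀ 1
    rwa [map_one] at h
  inv_mem' := fun hp => hp.inv

end GraphOfGroups

/-! `G` acts on its Bass–Serre tree, with vertices `X` and edges `Y`, so `0 → K[Y] → K[X] → K → 0`
is exact over every `B n`. The long exact sequence bounds `dim H_{j+1}(B n, K)` by `dim H_{j+1}(B n,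
K[X]) + dim H_j(B n, K[Y])` (`homologyDim_le_vertices_add_edges`). The shift in degree is why edge
groups must be slow in degree one too.

By Shapiro's lemma these terms are bounded by sums over `B n`-orbits of the homology of point
stabilizers. As `B n` is normal, the orbits inside `G • x` are parametrized by `G / (B n · G_x)`,
each with stabilizer isomorphic to `B n ∩ G_x`. Since `[G : B n] = [G : B n · G_x] [G_x : B n ∩
G_x]`, dividing by the index leaves a finite sum of the ratios for the chains `B n ∩ G_x` in the
stabilizers (`repHomologyDim_permRepresentation_div_index_le`), which tend to `0`.

Two facts about the tree replace normal forms: vertex groups embed in the path group, shown by a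
permutation action (`ofVertex_injective`), and there are no cycles, shown by a derivation serving as
a potential (`edgeBoundary_forest_injective`). -/

/-! ### Homology with coefficients and the long exact sequence. -/

section PermutationModule

open CategoryTheory

variable (K : Type u) [Field K] (G : Type u) [Group G]

/-- Additivity lets a decomposition of the identity of the coefficients pass to homology; on chains
the induced map acts coefficientwise. -/
instance groupHomology.functor_additive (n : ℕ) : (groupHomology.functor K G n).Additive where
  map_add {A B f g} := by
    have h : groupHomology.chainsMap (MonoidHom.id G) (f + g) =
        groupHomology.chainsMap (MonoidHom.id G) f +
          groupHomology.chainsMap (MonoidHom.id G) g := by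
      ext i : 1
      apply ModuleCat.hom_ext
      rw [HomologicalComplex.add_f_apply, ModuleCat.hom_add]
      simp only [groupHomology.chainsMap_id_f_hom_eq_mapRange]
      refine Finsupp.lhom_ext fun x a => ?_
      simp [Rep.add_hom]
    simp only [groupHomology.functor_map]
    rw [groupHomology.map, h, HomologicalComplex.homologyMap_add]
    rfl

/-- The permutation representation of `G` on the `K`-vector space with basis `X`. -/
noncomputable def permRepresentation (X : Type u) [MulAction G X] :
    Representation K G (X →₀ K) where
  toFun g := Finsupp.lmapDomain K K (g • ·)
  map_one' := by ext; simp
  map_mul' g h := by ext; simp [mul_smul]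

@[simp]
theorem permRepresentation_single {X : Type u} [MulAction G X] (g : G) (x : X) (r : K) :
    permRepresentation K G X g (Finsupp.single x r) = Finsupp.single (g • x) r := by
  simp [permRepresentation]

/-- The dimension of the homology of `G` with coefficients in `A`. -/
noncomputable def repHomologyDim {K G : Type u} [Field K] [Group G] (A : Rep.{u} K G) (j : ℕ) :
    ℕ∞ :=
  Cardinal.toENat (Module.rank K (groupHomology A j))

variable {K G}

theorem toENat_rank_le_add_of_exact {M N P : Type u} [AddCommGroup M] [Module K M]
    [AddCommGroup N] [Module K N] [AddCommGroup P] [Module K P] (f : M →ₗ[K] N) (g : N →ₗ[K] P)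
    (h : LinearMap.range f = LinearMap.ker g) :
    Cardinal.toENat (Module.rank K N) ≤
      Cardinal.toENat (Module.rank K M) + Cardinal.toENat (Module.rank K P) := by
  rw [← map_add, ← LinearMap.rank_range_add_rank_ker g, ← h, add_comm]
  exact OrderHomClass.mono _
    (add_le_add (LinearMap.rank_le_domain f) (Submodule.rank_le _))

theorem homologyDim_congr {H : Type u} [Group H] (e : G ≃* H) (j : ℕ) :
    homologyDim K G j = homologyDim K H j := by
  rw [homologyDim, homologyDim, (groupHomology.mapIso (A := Rep.trivial K G K)
    (B := Rep.trivial K H K) e (LinearEquiv.refl K K) (fun g => rfl) j).toLinearEquiv.rank_eq]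

/-- Shapiro's lemma. -/
theorem repHomologyDim_ind_trivial (S : Subgroup G) (j : ℕ) :
    repHomologyDim (Rep.ind S.subtype (Rep.trivial K S K)) j = homologyDim K S j := by
  classical
  rw [repHomologyDim, homologyDim,
    (groupHomology.indIso S (Rep.trivial K S K) j).toLinearEquiv.rank_eq]

/-- Homology is subadditive along a decomposition of the identity of the coefficients. -/
theorem repHomologyDim_le_sum {ι : Type u} [Fintype ι] (A : Rep.{u} K G) (M : ι → Rep.{u} K G)
    (i : ∀ k, M k ⟶ A) (p : ∀ k, A ⟶ M k) (h : ∑ k, p k ≫ i k = 𝟙 A) (j : ℕ) :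
    repHomologyDim A j ≤ ∑ k, repHomologyDim (M k) j := by
  classical
  let F := groupHomology.functor K G j
  have hF : ∑ k, F.map (p k) ≫ F.map (i k) = 𝟙 _ := by
    rw [← F.map_id, ← h, F.map_sum]
    simp
  have hid : (LinearMap.id : groupHomology A j →ₗ[K] groupHomology A j) =
      ∑ k, (F.map (i k)).hom ∘ₗ (F.map (p k)).hom := by
    simpa using! (congrArg ModuleCat.Hom.hom hF).symm
  rw [repHomologyDim, ← rank_top, ← LinearMap.range_id, hid]
  refine (OrderHomClass.mono Cardinal.toENat (LinearMap.rank_finsetSum_le _ _)).trans ?_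
  rw [map_sum]
  exact Finset.sum_le_sum fun k _ => OrderHomClass.mono Cardinal.toENat
    ((LinearMap.rank_comp_le_left _ _).trans (LinearMap.rank_le_domain _))

theorem homologyDim_le_of_shortExact (X : ShortComplex (Rep.{u} K G)) (hX : X.ShortExact)
    (j : ℕ) :
    repHomologyDim X.X₃ (j + 1) ≤ repHomologyDim X.X₂ (j + 1) + repHomologyDim X.X₁ j := by
  have h := groupHomology.mapShortComplex₃_exact hX (i := j + 1) (j := j) rfl
  exact toENat_rank_le_add_of_exact _ _ h.moduleCat_range_eq_ker

end PermutationModule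

/-! ### Permutation modules as sums of induced modules. -/

section OrbitDecomposition

open CategoryTheory

variable {K : Type u} [Field K] {G : Type u} [Group G] {X : Type u} [MulAction G X]

open Representation MulAction

/-- The induced module is a space of coinvariants, in which a left factor from the stabilizer is
absorbed. Hence the class of `g` depends only on the point `g⁻¹ • x`, which explains the inverses
below. -/
theorem indV_mk_stabilizer_mul (x : X) (s : stabilizer G x) (g : G) (r : K) :
    IndV.mk (stabilizer G x).subtype (Representation.trivial K (stabilizer G x) K) (s * g) r =
      IndV.mk (stabilizer G x).subtype (Representation.trivial K (stabilizer G x) K) g r := by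
  have := Coinvariants.mk_self_apply
    (Representation.tprod ((leftRegular K G).comp (stabilizer G x).subtype)
      (Representation.trivial K (stabilizer G x) K)) s
    (TensorProduct.tmul K (MonoidAlgebra.single g (1 : K)) r)
  simpa using! this

theorem indV_mk_eq_of_smul_eq (x : X) {g h : G} (e : g⁻¹ • x = h⁻¹ • x) (r : K) :
    IndV.mk (stabilizer G x).subtype (Representation.trivial K (stabilizer G x) K) g r =
      IndV.mk (stabilizer G x).subtype (Representation.trivial K (stabilizer G x) K) h r := by
  have hs : g * h⁻¹ ∈ stabilizer G x := by
    rw [mem_stabilizer_iff, mul_smul, ← e, smul_inv_smul]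
  simpa using indV_mk_stabilizer_mul x ⟨_, hs⟩ h r

variable (K) in
/-- The inclusion of the span of the orbit of `x` in the permutation module on `X`, the span being
written as an induced module. -/
noncomputable def orbitInclusion (x : X) :
    Rep.ind (stabilizer G x).subtype (Rep.trivial K (stabilizer G x) K) ⟶
      Rep.of (permRepresentation K G X) :=
  (Rep.indResHomEquiv (stabilizer G x).subtype (Rep.trivial K (stabilizer G x) K)
    (Rep.of (permRepresentation K G X))).symm
    (Rep.ofHom ⟨Finsupp.lsingle x, fun s => by
      refine LinearMap.ext_ring ?_
      change Finsupp.single x ((Representation.trivial K (stabilizer G x) K) s 1) =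
        permRepresentation K G X s (Finsupp.single x 1)
      rw [permRepresentation_single, mem_stabilizer_iff.1 s.2]
      rfl⟩)

@[simp]
theorem orbitInclusion_mk (x : X) (g : G) (r : K) :
    (orbitInclusion K x).hom (IndV.mk (stabilizer G x).subtype
      (Representation.trivial K (stabilizer G x) K) g r) = Finsupp.single (g⁻¹ • x) r := by
  simp [orbitInclusion, Rep.indResHomEquiv]

open Classical in
variable (K) in
/-- The projection of the permutation module on `X` to the span of the orbit of `x`, the span being
written as an induced module. -/
noncomputable def orbitProjection (x : X) :
    Rep.of (permRepresentation K G X) ⟶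
      Rep.ind (stabilizer G x).subtype (Rep.trivial K (stabilizer G x) K) :=
  Rep.ofHom ⟨Finsupp.lsum K fun y => if h : ∃ g : G, g⁻¹ • x = y then
      IndV.mk (stabilizer G x).subtype (Representation.trivial K (stabilizer G x) K) h.choose
    else 0, fun g => by
      refine Finsupp.lhom_ext fun y r => ?_
      simp only [LinearMap.comp_apply, permRepresentation_single, Finsupp.lsum_single]
      by_cases h : ∃ k : G, k⁻¹ • x = y
      · have h' : ∃ k : G, k⁻¹ • x = g • y := by
          obtain ⟨k, rfl⟩ := h
          exact ⟨k * g⁻¹, by simp [mul_smul]⟩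
        rw [dif_pos h, dif_pos h', ind_mk]
        -- The elements chosen for `y` and `g • y` are unrelated, but their classes depend only on
        -- the points reached.
        apply indV_mk_eq_of_smul_eq
        rw [h'.choose_spec, mul_inv_rev, inv_inv, mul_smul, h.choose_spec]
      · have h' : ¬ ∃ k : G, k⁻¹ • x = g • y := by
          rintro ⟨k, hk⟩
          exact h ⟨k * g, by rw [mul_inv_rev, mul_smul, hk, inv_smul_smul]⟩
        rw [dif_neg h, dif_neg h']
        simp⟩

theorem orbitProjection_comp_orbitInclusion_of_mem (x y : X) (h : y ∈ orbit G x) (r : K) :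
    (orbitProjection K (G := G) x ≫ orbitInclusion K x).hom (Finsupp.single y r : X →₀ K) =
      (Finsupp.single y r : X →₀ K) := by
  have h' : ∃ g : G, g⁻¹ • x = y := by
    obtain ⟨g, hg⟩ := h
    exact ⟨g⁻¹, by simpa using hg⟩
  have : (orbitProjection K (G := G) x).hom (Finsupp.single y r : X →₀ K) =
      IndV.mk (stabilizer G x).subtype (Representation.trivial K (stabilizer G x) K)
        h'.choose r := by
    change Finsupp.lsum K _ _ = _
    rw [Finsupp.lsum_single, dif_pos h']
  change (orbitInclusion K x).hom ((orbitProjection K x).hom _) = _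
  rw [this, orbitInclusion_mk, h'.choose_spec]

theorem orbitProjection_comp_orbitInclusion_of_notMem (x y : X) (h : y ∉ orbit G x) (r : K) :
    (orbitProjection K (G := G) x ≫ orbitInclusion K x).hom (Finsupp.single y r : X →₀ K) = 0 := by
  have h' : ¬ ∃ g : G, g⁻¹ • x = y := fun ⟨g, hg⟩ => h ⟨g⁻¹, hg⟩
  have : (orbitProjection K (G := G) x).hom (Finsupp.single y r : X →₀ K) = 0 := by
    change Finsupp.lsum K _ _ = _
    rw [Finsupp.lsum_single, dif_neg h', LinearMap.zero_apply]
  change (orbitInclusion K x).hom ((orbitProjection K x).hom _) = _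
  rw [this, map_zero]

theorem rep_sum_hom_apply {A B : Rep.{u} K G} {ι : Type*} [Fintype ι] (f : ι → (A ⟶ B)) (z : A) :
    (∑ i, f i).hom z = ∑ i, (f i).hom z := by
  rw [Rep.sum_hom]
  exact Representation.IntertwiningMap.sum_apply _ _ _ _ _

theorem permRepresentation_hom_eq_id
    (f : Rep.of (permRepresentation K G X) ⟶ Rep.of (permRepresentation K G X))
    (h : ∀ (y : X) (r : K), f.hom (Finsupp.single y r : X →₀ K) = (Finsupp.single y r : X →₀ K)) :
    f = 𝟙 _ := by
  apply Rep.hom_ext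
  have : f.hom.toLinearMap = LinearMap.id := Finsupp.lhom_ext h
  exact Representation.IntertwiningMap.ext this

/-- The homology of a permutation module with finitely many orbits is bounded by the homology of
the point stabilizers. -/
theorem repHomologyDim_permRepresentation_le [Fintype (orbitRel.Quotient G X)] (j : ℕ) :
    repHomologyDim (Rep.of (permRepresentation K G X)) j ≤
      ∑ ω : orbitRel.Quotient G X, homologyDim K (stabilizer G ω.out) j := by
  classical
  have key := repHomologyDim_le_sum (Rep.of (permRepresentation K G X))
    (fun ω : orbitRel.Quotient G X =>
      Rep.ind (stabilizer G ω.out).subtype (Rep.trivial K (stabilizer G ω.out) K))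
    (fun ω => orbitInclusion K ω.out) (fun ω => orbitProjection K ω.out) ?_ j
  · simpa only [repHomologyDim_ind_trivial] using key
  refine permRepresentation_hom_eq_id _ fun y r => ?_
  refine (rep_sum_hom_apply _ _).trans ?_
  rw [Finset.sum_eq_single (Quotient.mk'' y)]
  · exact orbitProjection_comp_orbitInclusion_of_mem _ _
      (mem_orbit_symm.1 (Quotient.mk_out (s := orbitRel G X) y)) r
  · intro ω _ hω
    refine orbitProjection_comp_orbitInclusion_of_notMem _ _ (fun h => hω ?_) r
    rw [← Quotient.out_eq' ω]
    exact (Quotient.sound' (s₁ := orbitRel G X) h).symm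
  · simp

end OrbitDecomposition

/-! ### The chain complex of a tree. -/

section EdgeBoundary

open CategoryTheory

variable (K : Type u) [Field K] {X Y : Type*} (s t : Y → X)

/-- The boundary map from edges to vertices of the graph with edge set `Y`, vertex set `X` and
endpoint maps `s` and `t`. -/
noncomputable def edgeBoundary : (Y →₀ K) →ₗ[K] (X →₀ K) :=
  Finsupp.lmapDomain K K t - Finsupp.lmapDomain K K s

/-- The sum of the coefficients. -/
noncomputable def sumCoeff (X : Type*) : (X →₀ K) →ₗ[K] K :=
  Finsupp.lsum K fun _ => LinearMap.id

variable {K}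

@[simp]
theorem edgeBoundary_single (y : Y) (r : K) :
    edgeBoundary K s t (Finsupp.single y r) = Finsupp.single (t y) r - Finsupp.single (s y) r := by
  simp [edgeBoundary]

@[simp]
theorem sumCoeff_single (x : X) (r : K) : sumCoeff K X (Finsupp.single x r) = r := by
  simp [sumCoeff]

theorem sumCoeff_comp_edgeBoundary : sumCoeff K X ∘ₗ edgeBoundary K s t = 0 := by
  refine Finsupp.lhom_ext fun y r => ?_
  simp

theorem single_sub_single_mem_range_edgeBoundary {a b : X}
    (h : Relation.EqvGen (fun a b => ∃ y, s y = a ∧ t y = b) a b) (r : K) :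
    Finsupp.single b r - Finsupp.single a r ∈ LinearMap.range (edgeBoundary K s t) := by
  induction h with
  | rel a b h =>
    obtain ⟨y, rfl, rfl⟩ := h
    exact ⟨Finsupp.single y r, edgeBoundary_single s t y r⟩
  | refl a => simp
  | symm a b _ ih => simpa using neg_mem ih
  | trans a b c _ _ h₁ h₂ => simpa using add_mem h₂ h₁

theorem range_edgeBoundary_eq_ker_sumCoeff [Nonempty X]
    (h : ∀ a b, Relation.EqvGen (fun a b => ∃ y, s y = a ∧ t y = b) a b) :
    LinearMap.range (edgeBoundary K s t) = LinearMap.ker (sumCoeff K X) := by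
  apply le_antisymm
  · rw [LinearMap.range_le_ker_iff, sumCoeff_comp_edgeBoundary]
  · intro f hf
    obtain ⟨a⟩ := ‹Nonempty X›
    -- Modulo boundaries, every 0-chain can be concentrated at the base vertex `a`.
    have key : ∀ f : X →₀ K, f - Finsupp.single a (sumCoeff K X f) ∈
        LinearMap.range (edgeBoundary K s t) := by
      intro f
      induction f using Finsupp.induction_linear with
      | zero => simp
      | add f g hf hg =>
        rw [map_add, Finsupp.single_add, add_sub_add_comm]
        exact add_mem hf hg
      | single x r =>
        rw [sumCoeff_single]
        exact single_sub_single_mem_range_edgeBoundary s t (h a x) r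
    simpa [LinearMap.mem_ker.1 hf] using key f

theorem Rep.shortExact_of_linear {G : Type u} [Group G] (S : ShortComplex (Rep.{u} K G))
    (hf : Function.Injective S.f.hom)
    (h : LinearMap.range S.f.hom.toLinearMap = LinearMap.ker S.g.hom.toLinearMap)
    (hg : Function.Surjective S.g.hom) : S.ShortExact where
  exact := by
    rw [← ShortComplex.exact_map_iff_of_faithful S (forget₂ (Rep K G) (ModuleCat K)),
      ShortComplex.moduleCat_exact_iff_range_eq_ker]
    exact h
  mono_f := (Rep.mono_iff_injective _).2 hf
  epi_g := (Rep.epi_iff_surjective _).2 hg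

/-- The homology of a group acting on a tree is bounded by the homology with coefficients in the
permutation modules on the vertices and the edges. -/
theorem homologyDim_le_vertices_add_edges {G X Y : Type u} [Group G] (s t : Y → X)
    [MulAction G X] [MulAction G Y]
    (hs : ∀ (g : G) y, s (g • y) = g • s y) (ht : ∀ (g : G) y, t (g • y) = g • t y)
    (hinj : Function.Injective (edgeBoundary K s t)) [Nonempty X]
    (hconn : ∀ a b, Relation.EqvGen (fun a b => ∃ y, s y = a ∧ t y = b) a b) (j : ℕ) :
    homologyDim K G (j + 1) ≤
      repHomologyDim (Rep.of (permRepresentation K G X)) (j + 1) +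
        repHomologyDim (Rep.of (permRepresentation K G Y)) j := by
  let f : Rep.of (permRepresentation K G Y) ⟶ Rep.of (permRepresentation K G X) :=
    Rep.ofHom ⟨edgeBoundary K s t, fun g => Finsupp.lhom_ext fun y r => by simp [hs, ht]⟩
  let p : Rep.of (permRepresentation K G X) ⟶ Rep.trivial K G K :=
    Rep.ofHom ⟨sumCoeff K X, fun g => Finsupp.lhom_ext fun x r => by simp⟩
  have hfp : f ≫ p = 0 := by
    apply Rep.hom_ext
    apply Representation.IntertwiningMap.ext
    exact sumCoeff_comp_edgeBoundary s t
  refine homologyDim_le_of_shortExact (ShortComplex.mk f p hfp)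
    (Rep.shortExact_of_linear _ hinj ?_ fun r => ?_) j
  · exact range_edgeBoundary_eq_ker_sumCoeff s t hconn
  · obtain ⟨a⟩ := ‹Nonempty X›
    exact ⟨Finsupp.single a r, sumCoeff_single a r⟩

end EdgeBoundary

/-! ### Orbits and stabilizers of a normal subgroup. -/

section OrbitCount

variable {G : Type u} [Group G] {X : Type u} [MulAction G X] (N : Subgroup G)

open MulAction

/-- Conjugation identifies the stabilizer of `g • x` in a normal subgroup with that of `x`. -/
noncomputable def stabilizerNormalEquiv [N.Normal] (x : X) (g : G) :
    stabilizer N (g • x) ≃* N.subgroupOf (stabilizer G x) where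
  toFun n := ⟨⟨g⁻¹ * n.1.1 * g, by
    have := mem_stabilizer_iff.1 n.2
    rw [mem_stabilizer_iff, mul_smul, mul_smul, inv_smul_eq_iff]
    exact this⟩, by
    rw [Subgroup.mem_subgroupOf]
    simpa using ‹N.Normal›.conj_mem n.1.1 n.1.2 g⁻¹⟩
  invFun h := ⟨⟨g * h.1.1 * g⁻¹, ‹N.Normal›.conj_mem _ (Subgroup.mem_subgroupOf.1 h.2) g⟩, by
    rw [mem_stabilizer_iff, Subgroup.mk_smul, mul_smul, inv_smul_smul, mul_smul,
      mem_stabilizer_iff.1 h.1.2]⟩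
  left_inv n := by
    ext
    simp [mul_assoc]
  right_inv h := by
    ext
    simp [mul_assoc]
  map_mul' m n := by
    ext
    simp [mul_assoc]

/-- The cosets of `N ⊔ stabilizer G x`, for `x` running through representatives of the `G`-orbits,
parametrize the `N`-orbits. -/
noncomputable def cosetToOrbit [N.Normal] :
    (Σ ν : orbitRel.Quotient G X, G ⧸ (N ⊔ stabilizer G ν.out)) → orbitRel.Quotient N X :=
  fun p => Quotient.liftOn' p.2 (fun g => Quotient.mk'' (g • p.1.out)) fun a b hab => by
    rw [QuotientGroup.leftRel_apply] at hab
    obtain ⟨n, hn, h, hh, e⟩ := Subgroup.mem_sup_of_normal_left.1 hab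
    refine Quotient.sound' ?_
    refine ⟨⟨a * n⁻¹ * a⁻¹, ‹N.Normal›.conj_mem _ (inv_mem hn) a⟩, ?_⟩
    have hb : b = a * (n * h) := by rw [e, mul_inv_cancel_left]
    change (a * n⁻¹ * a⁻¹) • b • p.1.out = a • p.1.out
    rw [hb, ← mul_smul]
    have : a * n⁻¹ * a⁻¹ * (a * (n * h)) = a * h := by group
    rw [this, mul_smul, mem_stabilizer_iff.1 hh]

theorem cosetToOrbit_surjective [N.Normal] :
    Function.Surjective (cosetToOrbit (X := X) N) := by
  intro ω
  induction ω using Quotient.inductionOn' with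
  | h x =>
    obtain ⟨g, hg⟩ := mem_orbit_symm.1 (Quotient.mk_out (s := orbitRel G X) x)
    refine ⟨⟨Quotient.mk'' x, QuotientGroup.mk g⟩, ?_⟩
    exact congrArg Quotient.mk'' hg

/-- The representative chosen in the `N`-orbit of `g • ν.out` is `(n * g) • ν.out` for some `n` in
`N`; conjugate by `n * g`. -/
theorem homologyDim_stabilizer_cosetToOrbit (K : Type u) [Field K] [N.Normal]
    (p : Σ ν : orbitRel.Quotient G X, G ⧸ (N ⊔ stabilizer G ν.out)) (j : ℕ) :
    homologyDim K (stabilizer N (cosetToOrbit N p).out) j =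
      homologyDim K (N.subgroupOf (stabilizer G p.1.out)) j := by
  obtain ⟨ν, c⟩ := p
  induction c using QuotientGroup.induction_on with
  | H g =>
    obtain ⟨n, hn⟩ := Quotient.mk_out (s := orbitRel N X) (g • ν.out)
    have e : (n * g : G) • ν.out = (cosetToOrbit N ⟨ν, (g : G ⧸ _)⟩).out := by
      rw [mul_smul]
      exact hn
    rw [← e]
    exact homologyDim_congr (stabilizerNormalEquiv N ν.out (n * g)) j

/-- Second isomorphism theorem: `N` has the same index in `N ⊔ H` as `N ∩ H` has in `H`. -/
theorem index_sup_mul_index_subgroupOf [N.Normal] (H : Subgroup G) :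
    (N ⊔ H).index * (N.subgroupOf H).index = N.index := by
  have h := Subgroup.relIndex_mul_index (le_sup_left : N ≤ N ⊔ H)
  rw [Subgroup.relIndex_sup_left] at h
  rw [mul_comm]
  exact h

/-- The homology of a normal subgroup with coefficients in a permutation module, relative to the
index. -/
theorem repHomologyDim_permRepresentation_div_index_le (K : Type u) [Field K] [N.Normal]
    [N.FiniteIndex] [Fintype (orbitRel.Quotient G X)] (j : ℕ) :
    ((repHomologyDim (Rep.of (permRepresentation K N X)) j : ℕ∞) : ℝ≥0∞) / (N.index : ℝ≥0∞) ≤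
      ∑ ν : orbitRel.Quotient G X,
        ((homologyDim K (N.subgroupOf (stabilizer G ν.out)) j : ℕ∞) : ℝ≥0∞) /
          ((N.subgroupOf (stabilizer G ν.out)).index : ℝ≥0∞) := by
  classical
  have hfin : ∀ ν : orbitRel.Quotient G X, (N ⊔ stabilizer G ν.out).FiniteIndex :=
    fun ν => Subgroup.finiteIndex_of_le le_sup_left
  let _ : ∀ ν : orbitRel.Quotient G X, Fintype (G ⧸ (N ⊔ stabilizer G ν.out)) :=
    fun ν => Subgroup.fintypeQuotientOfFiniteIndex
  have hsurj := cosetToOrbit_surjective (X := X) N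
  let _ : Fintype (orbitRel.Quotient N X) := Fintype.ofSurjective _ hsurj
  have h1 : repHomologyDim (Rep.of (permRepresentation K N X)) j ≤
      ∑ ν : orbitRel.Quotient G X, ((N ⊔ stabilizer G ν.out).index : ℕ∞) *
        homologyDim K (N.subgroupOf (stabilizer G ν.out)) j := by
    calc _ ≤ ∑ ω : orbitRel.Quotient N X, homologyDim K (stabilizer N ω.out) j :=
          repHomologyDim_permRepresentation_le j
      -- Orbits are reindexed by a section of `cosetToOrbit`. Only an upper bound is needed, so
      -- surjectivity suffices and the other cosets may be added.
      _ = ∑ ω : orbitRel.Quotient N X, homologyDim K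
            (stabilizer N (cosetToOrbit N (Function.surjInv hsurj ω)).out) j := by
          exact Finset.sum_congr rfl fun ω _ => by rw [Function.surjInv_eq hsurj ω]
      _ = ∑ p ∈ Finset.univ.image (Function.surjInv hsurj),
            homologyDim K (stabilizer N (cosetToOrbit N p).out) j := by
          rw [Finset.sum_image (Function.injective_surjInv hsurj).injOn]
      _ ≤ ∑ p, homologyDim K (stabilizer N (cosetToOrbit N p).out) j :=
          Finset.sum_le_sum_of_subset (Finset.subset_univ _)
      _ = _ := by
          rw [Fintype.sum_sigma]
          refine Finset.sum_congr rfl fun ν _ => ?_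
          rw [Finset.sum_eq_card_nsmul (b := homologyDim K (N.subgroupOf (stabilizer G ν.out)) j)
            fun c _ => homologyDim_stabilizer_cosetToOrbit N K ⟨ν, c⟩ j, Finset.card_univ, nsmul_eq_mul,
            Subgroup.index, Nat.card_eq_fintype_card]
  refine (ENNReal.div_le_div_right (ENat.toENNReal_mono h1) _).trans ?_
  have h2 := map_sum ENat.toENNRealRingHom (fun ν : orbitRel.Quotient G X =>
    ((N ⊔ stabilizer G ν.out).index : ℕ∞) *
      homologyDim K (N.subgroupOf (stabilizer G ν.out)) j) Finset.univ
  simp only [ENat.toENNRealRingHom_apply, ENat.toENNReal_mul, ENat.toENNReal_coe] at h2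
  rw [h2, div_eq_mul_inv, Finset.sum_mul]
  refine Finset.sum_le_sum fun ν _ => le_of_eq ?_
  rw [← div_eq_mul_inv, ← index_sup_mul_index_subgroupOf N (stabilizer G ν.out), Nat.cast_mul]
  exact ENNReal.mul_div_mul_left _ _ (Nat.cast_ne_zero.2 (hfin ν).index_ne_zero)
    (ENNReal.natCast_ne_top _)

end OrbitCount

/-! ### Homology gradients of a group acting on a tree. -/

section Gradient

variable {K : Type u} [Field K] {G : Type u} [Group G]

open MulAction

/-- Applied to the inclusion of a stabilizer, this makes the traces of the chain an exhausting
normal chain there, to which slowness applies. -/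
theorem IsExhaustingNormalChain.comap {H : Type u} [Group H] {B : ℕ → Subgroup G}
    (hB : IsExhaustingNormalChain B) (f : H →* G) (hf : Function.Injective f) :
    IsExhaustingNormalChain fun n => (B n).comap f where
  antitone _ _ h := Subgroup.comap_mono (hB.antitone h)
  normal n := (hB.normal n).comap f
  finiteIndex n :=
    have := hB.normal n
    ⟨by
      rw [Subgroup.index_comap]
      exact ne_zero_of_dvd_ne_zero (hB.finiteIndex n).index_ne_zero
        (Subgroup.relIndex_dvd_index_of_normal _ _)⟩
  iInf_eq_bot := by
    rw [← Subgroup.comap_iInf, hB.iInf_eq_bot, MonoidHom.comap_bot, MonoidHom.ker_eq_bot_iff]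
    exact hf

theorem HomologyGradientVanishes.of_mulEquiv {H : Type u} [Group H] {j : ℕ}
    (h : HomologyGradientVanishes K G j) (e : G ≃* H) : HomologyGradientVanishes K H j := by
  intro B hB
  refine (h _ (hB.comap e.toMonoidHom e.injective)).congr fun n => ?_
  rw [(B n).index_comap_of_surjective e.surjective,
    homologyDim_congr (e.subgroupMap ((B n).comap e.toMonoidHom))]
  have : ((B n).comap e.toMonoidHom).map e.toMonoidHom = B n :=
    Subgroup.map_comap_eq_self_of_surjective e.surjective _
  rw [MulEquiv.toMonoidHom_eq_coe] at this ⊢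
  rw [this]

theorem tendsto_repHomologyDim_permRepresentation {X : Type u} [MulAction G X]
    [Finite (orbitRel.Quotient G X)] {j : ℕ}
    (h : ∀ x : X, HomologyGradientVanishes K (stabilizer G x) j) {B : ℕ → Subgroup G}
    (hB : IsExhaustingNormalChain B) :
    Tendsto (fun n => ((repHomologyDim (Rep.of (permRepresentation K (B n) X)) j : ℕ∞) : ℝ≥0∞) /
      ((B n).index : ℝ≥0∞)) atTop (𝓝 0) := by
  have := Fintype.ofFinite (orbitRel.Quotient G X)
  have hsum := tendsto_finsetSum Finset.univ fun (ν : orbitRel.Quotient G X) _ =>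
    h ν.out _ (hB.comap (stabilizer G ν.out).subtype (Subgroup.subtype_injective _))
  rw [Finset.sum_const_zero] at hsum
  refine tendsto_of_tendsto_of_tendsto_of_le_of_le tendsto_const_nhds hsum
    (fun _ => zero_le) fun n => ?_
  have := hB.normal n
  have := hB.finiteIndex n
  exact repHomologyDim_permRepresentation_div_index_le (B n) K j

/-- Slowness above dimension one of a group acting on a tree with finitely many orbits; the tree is
given by its vertices `X`, its edges `Y` and the endpoint maps `s` and `t`, and the absence of
cycles is expressed by the injectivity of the boundary map. -/
theorem isKSlowAboveDimOne_of_action_on_tree {X Y : Type u} [MulAction G X] [MulAction G Y]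
    [Finite (orbitRel.Quotient G X)] [Finite (orbitRel.Quotient G Y)] (s t : Y → X)
    (hs : ∀ (g : G) y, s (g • y) = g • s y) (ht : ∀ (g : G) y, t (g • y) = g • t y)
    (hinj : Function.Injective (edgeBoundary K s t)) [Nonempty X]
    (hconn : ∀ a b, Relation.EqvGen (fun a b => ∃ y, s y = a ∧ t y = b) a b)
    (hG : Group.ResiduallyFinite G)
    (hX : ∀ (x : X) j, 2 ≤ j → HomologyGradientVanishes K (stabilizer G x) j)
    (hY : ∀ (y : Y) j, 1 ≤ j → HomologyGradientVanishes K (stabilizer G y) j) :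
    IsKSlowAboveDimOne K G where
  residuallyFinite := hG
  vanishes j hj B hB := by
    -- From here the degree is `j + 1`, and the edges contribute in degree `j ≥ 1`.
    obtain ⟨j, rfl⟩ := Nat.exists_eq_add_of_le' (one_le_two.trans hj)
    have h := (tendsto_repHomologyDim_permRepresentation (fun x : X => hX x _ hj) hB).add
      (tendsto_repHomologyDim_permRepresentation (fun y : Y => hY y j (by omega)) hB)
    rw [add_zero] at h
    refine tendsto_of_tendsto_of_tendsto_of_le_of_le tendsto_const_nhds h
      (fun _ => zero_le) fun n => ?_
    rw [← ENNReal.add_div, ← ENat.toENNReal_add]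
    exact ENNReal.div_le_div_right (ENat.toENNReal_mono
      (homologyDim_le_vertices_add_edges (G := B n) s t (fun g y => hs g y) (fun g y => ht g y)
        hinj hconn j)) _

end Gradient

/-! ### Free actions with many orbits. -/

section FreeActions

theorem nonempty_prod_equiv_self (Q Ω : Type*) [Nonempty Q] [Infinite Ω] (f : Q ↪ Ω) :
    Nonempty (Q × Ω ≃ Ω) := by
  obtain ⟨e⟩ : Nonempty (Ω × Ω ≃ Ω) := Cardinal.eq.1 <| by
    rw [Cardinal.mk_prod, Cardinal.lift_id, Cardinal.mul_eq_self (Cardinal.aleph0_le_mk Ω)]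
  obtain ⟨q⟩ := ‹Nonempty Q›
  exact Function.Embedding.antisymm ((f.prodMap (Function.Embedding.refl Ω)).trans e.toEmbedding)
    ⟨fun ω => (q, ω), fun _ _ h => (Prod.mk.inj h).2⟩

/-- The restriction of the action of `A` on `A × Ω` to a subgroup `C` is isomorphic to the action
of `C` on `C × Ω` if `Ω` is infinite and not smaller than `A`. -/
theorem exists_prod_equiv_prod_of_injective {C A : Type*} [Group C] [Group A] (f : C →* A)
    (hf : Function.Injective f) (Ω : Type*) [Infinite Ω] (i : A ↪ Ω) :
    ∃ θ : C × Ω ≃ A × Ω, ∀ c x ω, θ (c * x, ω) = (f c * (θ (x, ω)).1, (θ (x, ω)).2) := by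
  -- `A` is a free left `C`-set. Its orbits are right cosets of `f.range`, while the quotient
  -- consists of left cosets, hence the inverse.
  let ψ : C × (A ⧸ f.range) → A := fun p => f p.1 * (p.2.out)⁻¹
  have hψ : Function.Bijective ψ := by
    constructor
    · rintro ⟨c, q⟩ ⟨c', q'⟩ (h : f c * q.out⁻¹ = f c' * q'.out⁻¹)
      have hq : q = q' := by
        rw [← q.out_eq', ← q'.out_eq']
        refine QuotientGroup.eq.2 ⟨c⁻¹ * c', ?_⟩
        rw [map_mul, map_inv, inv_mul_eq_iff_eq_mul, ← mul_assoc, h, inv_mul_cancel_right]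
      subst hq
      rw [mul_left_inj] at h
      rw [hf h]
    · intro a
      obtain ⟨⟨_, c, rfl⟩, hc⟩ := QuotientGroup.mk_out_eq_mul f.range a⁻¹
      refine ⟨(c, QuotientGroup.mk a⁻¹), ?_⟩
      change f c * (Quotient.out (QuotientGroup.mk a⁻¹ : A ⧸ f.range))⁻¹ = a
      rw [hc]
      simp
  obtain ⟨e⟩ := nonempty_prod_equiv_self (A ⧸ f.range) Ω
    ((Function.Embedding.mk Quotient.out Quotient.out_injective).trans i)
  refine ⟨((Equiv.refl C).prodCongr e.symm).trans ((Equiv.prodAssoc _ _ _).symm.trans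
    ((Equiv.ofBijective ψ hψ).prodCongr (Equiv.refl Ω))), fun c x ω => ?_⟩
  simp [ψ, mul_assoc]

end FreeActions

/-! ### The path group and the embedding of vertex groups. -/

namespace GraphOfGroups

variable {V : Type v} {E : Type w} (𝒢 : GraphOfGroups.{u} V E)

section Lift

variable {P : Type*} [Group P] (ρ : ∀ x, 𝒢.vertexGroup x →* P) (T : E → P)
  (h : ∀ e a, ρ (𝒢.init e) (𝒢.initHom e a) * T e = T e * ρ (𝒢.term e) (𝒢.termHom e a))

/-- The universal property of the path group. -/
def pathGroupLift : 𝒢.PathGroup →* P :=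
  QuotientGroup.lift _ (Monoid.Coprod.lift (Monoid.CoprodI.lift ρ) (FreeGroup.lift T)) <| by
    refine Subgroup.normalClosure_le_normal (N := MonoidHom.ker _) ?_
    rintro _ ⟨e, a, rfl⟩
    change _ = _
    simp [h e a]

@[simp]
theorem pathGroupLift_ofVertex (x : V) (g : 𝒢.vertexGroup x) :
    𝒢.pathGroupLift ρ T h (𝒢.ofVertex x g) = ρ x g := by
  change Monoid.Coprod.lift (Monoid.CoprodI.lift ρ) (FreeGroup.lift T)
    (Monoid.Coprod.inl (Monoid.CoprodI.of g)) = _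
  simp

@[simp]
theorem pathGroupLift_stable (e : E) : 𝒢.pathGroupLift ρ T h (𝒢.stable e) = T e := by
  change Monoid.Coprod.lift (Monoid.CoprodI.lift ρ) (FreeGroup.lift T)
    (Monoid.Coprod.inr (FreeGroup.of e)) = _
  simp

variable {𝒢} in
theorem pathGroup_hom_ext {f₁ f₂ : 𝒢.PathGroup →* P}
    (hv : ∀ x g, f₁ (𝒢.ofVertex x g) = f₂ (𝒢.ofVertex x g))
    (he : ∀ e, f₁ (𝒢.stable e) = f₂ (𝒢.stable e)) : f₁ = f₂ := by
  refine QuotientGroup.monoidHom_ext _ (Monoid.Coprod.hom_ext ?_ ?_)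
  · exact Monoid.CoprodI.ext_hom _ _ fun x => MonoidHom.ext (hv x)
  · exact FreeGroup.ext_hom _ _ he

end Lift

theorem ofVertex_mul_stable (e : E) (a : 𝒢.edgeGroup e) :
    𝒢.ofVertex (𝒢.init e) (𝒢.initHom e a) * 𝒢.stable e =
      𝒢.stable e * 𝒢.ofVertex (𝒢.term e) (𝒢.termHom e a) := by
  rw [← mul_inv_eq_one]
  exact (QuotientGroup.eq_one_iff _).2 (Subgroup.subset_normalClosure ⟨e, a, rfl⟩)

/-- All vertex groups act freely on one set `Ω`, each through a bijection `κ x` of `G_x × Ω` with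
`Ω`. Restricted to an edge group `C` along either embedding, the action becomes `C × Ω`, so some
permutation `T e` intertwines the two. The path group then acts on `Ω`, extending the faithful
actions of the vertex groups. -/
theorem ofVertex_injective (x : V) : Function.Injective (𝒢.ofVertex x) := by
  classical
  -- The first summand contains every vertex group; the second makes `Ω` infinite.
  let Ω := (Σ x, 𝒢.vertexGroup x) ⊕ ℕ
  let i : ∀ x, 𝒢.vertexGroup x ↪ Ω := fun x =>
    ⟨fun g => Sum.inl ⟨x, g⟩, fun _ _ e => sigma_mk_injective (Sum.inl_injective e)⟩
  have κ : ∀ x, 𝒢.vertexGroup x × Ω ≃ Ω := fun x =>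
    (nonempty_prod_equiv_self (𝒢.vertexGroup x) Ω (i x)).some
  let ρ : ∀ x, 𝒢.vertexGroup x →* Equiv.Perm Ω := fun x =>
    { toFun := fun g => (κ x).permCongr ((Equiv.mulLeft g).prodCongr (Equiv.refl Ω))
      map_one' := by ext; simp
      map_mul' := fun g h => by ext; simp [Prod.map] }
  have hρ : ∀ x g p, ρ x g (κ x p) = κ x (g * p.1, p.2) := fun x g p => by simp [ρ, Prod.map]
  choose θ hθ using fun e => exists_prod_equiv_prod_of_injective (𝒢.initHom e)
    (𝒢.initHom_injective e) Ω (i _)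
  choose η hη using fun e => exists_prod_equiv_prod_of_injective (𝒢.termHom e)
    (𝒢.termHom_injective e) Ω (i _)
  let T : E → Equiv.Perm Ω := fun e =>
    ((η e).trans (κ _)).symm.trans ((θ e).trans (κ _))
  have hT : ∀ e p, T e (κ _ (η e p)) = κ _ (θ e p) := fun e p => by simp [T]
  have h : ∀ e a, ρ (𝒢.init e) (𝒢.initHom e a) * T e =
      T e * ρ (𝒢.term e) (𝒢.termHom e a) := by
    intro e a
    ext ω : 1
    obtain ⟨⟨c, ω⟩, rfl⟩ := ((η e).trans (κ _)).surjective ω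
    simp only [Equiv.Perm.mul_apply, Equiv.trans_apply, hT, hρ]
    rw [← hη, hT, hθ]
  intro g g' e
  have e' := congrArg (𝒢.pathGroupLift ρ T h) e
  rw [pathGroupLift_ofVertex, pathGroupLift_ofVertex] at e'
  have := DFunLike.congr_fun e' (κ x (1, Sum.inr 0))
  simpa [hρ] using this

end GraphOfGroups

/-! ### Maps of graphs, potentials, and moving the tree into the universe of `G`. -/

section SmallModel

open MulAction

/-- A set with finitely many orbits is isomorphic to one in the universe of the group. -/
theorem exists_equivariant_equiv_of_finite_orbits {G : Type u} [Group G] {X : Type*}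
    [MulAction G X] [Finite (orbitRel.Quotient G X)] :
    ∃ (X' : Type u) (_ : MulAction G X') (e : X' ≃ X), ∀ (g : G) x, e (g • x) = g • e x := by
  obtain ⟨n, ⟨i⟩⟩ := Finite.exists_equiv_fin (orbitRel.Quotient G X)
  have hX : Small.{u} X :=
    small_of_surjective (f := fun p : Fin n × G => p.2 • (i.symm p.1).out) fun x => by
      obtain ⟨g, hg⟩ := mem_orbit_symm.1 (Quotient.mk_out (s := orbitRel G X) x)
      refine ⟨(i (Quotient.mk'' x), g), ?_⟩
      change g • (i.symm (i (Quotient.mk'' x))).out = x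
      rw [Equiv.symm_apply_apply]
      exact hg
  refine ⟨Shrink.{u} X, (equivShrink X).symm.mulAction G, (equivShrink X).symm, fun g x => ?_⟩
  exact (equivShrink X).symm_apply_apply _

theorem finite_orbits_of_equivariant_equiv {G X X' : Type*} [Group G] [MulAction G X]
    [MulAction G X'] [Finite (orbitRel.Quotient G X)] (e : X' ≃ X)
    (he : ∀ (g : G) x, e (g • x) = g • e x) : Finite (orbitRel.Quotient G X') := by
  refine Finite.of_injective (β := orbitRel.Quotient G X)
    (Quotient.map' e fun a b ⟨g, hg⟩ => ⟨g, ?_⟩) fun a b => ?_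
  · rw [← hg]
    exact (he g b).symm
  · refine Quotient.inductionOn₂' a b fun a b h => Quotient.sound' ?_
    obtain ⟨g, hg⟩ := Quotient.exact' h
    exact ⟨g, e.injective ((he g b).trans hg)⟩

theorem edgeBoundary_comp_lmapDomain (K : Type u) [Field K] {X X' Y Y' : Type*} (s t : Y → X)
    (s' t' : Y' → X') (q : X' → X) (r : Y' → Y) (hs : ∀ y, q (s' y) = s (r y))
    (ht : ∀ y, q (t' y) = t (r y)) :
    edgeBoundary K s t ∘ₗ Finsupp.lmapDomain K K r =
      Finsupp.lmapDomain K K q ∘ₗ edgeBoundary K s' t' := by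
  refine Finsupp.lhom_ext fun y a => ?_
  simp only [LinearMap.comp_apply, Finsupp.lmapDomain_apply, Finsupp.mapDomain_single,
    edgeBoundary_single, Finsupp.mapDomain_sub, hs, ht]

/-- A nonzero cycle would map to a nonzero cycle, since `r` is injective on edges; `q` may identify
vertices. -/
theorem edgeBoundary_injective_of_map (K : Type u) [Field K] {X X' Y Y' : Type*} (s t : Y → X)
    (s' t' : Y' → X') (q : X' → X) (r : Y' → Y) (hs : ∀ y, q (s' y) = s (r y))
    (ht : ∀ y, q (t' y) = t (r y)) (hr : Function.Injective r)
    (h : Function.Injective (edgeBoundary K s t)) : Function.Injective (edgeBoundary K s' t') := by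
  have := h.comp (Finsupp.mapDomain_injective hr)
  refine Function.Injective.of_comp (f := Finsupp.lmapDomain K K q) ?_
  have e := edgeBoundary_comp_lmapDomain K s t s' t' q r hs ht
  rw [← LinearMap.coe_comp, ← e]
  exact this

/-- A graph has no cycles if there is a potential on its vertices. -/
theorem edgeBoundary_injective_of_potential (K : Type u) [Field K] {X Y : Type*} (s t : Y → X)
    (p : X → Y → K) (hp : ∀ y, p (t y) - p (s y) = fun z => Finsupp.single y (1 : K) z) :
    Function.Injective (edgeBoundary K s t) := by
  -- The linear extension of the potential is a left inverse of the boundary, up to the inclusion of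
  -- finitely supported functions into all functions.
  let L : (X →₀ K) →ₗ[K] (Y → K) := Finsupp.linearCombination K p
  have hL : ∀ f : Y →₀ K, L (edgeBoundary K s t f) = f := by
    intro f
    induction f using Finsupp.induction_linear with
    | zero => simp
    | add f g hf hg => rw [map_add, map_add, hf, hg, Finsupp.coe_add]
    | single y r =>
      rw [edgeBoundary_single, map_sub, Finsupp.linearCombination_single,
        Finsupp.linearCombination_single, ← smul_sub, hp]
      ext z
      by_cases h : y = z <;> simp [h]
  intro f g h
  exact DFunLike.coe_injective ((hL f).symm.trans ((congrArg L h).trans (hL g)))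

/-- `isKSlowAboveDimOne_of_action_on_tree` for vertex and edge sets in arbitrary universes. -/
theorem isKSlowAboveDimOne_of_action_on_large_tree {K : Type u} [Field K] {G : Type u} [Group G]
    {X : Type*} {Y : Type*} [MulAction G X] [MulAction G Y]
    [Finite (orbitRel.Quotient G X)] [Finite (orbitRel.Quotient G Y)] (s t : Y → X)
    (hs : ∀ (g : G) y, s (g • y) = g • s y) (ht : ∀ (g : G) y, t (g • y) = g • t y)
    (hinj : Function.Injective (edgeBoundary K s t)) [Nonempty X]
    (hconn : ∀ a b, Relation.EqvGen (fun a b => ∃ y, s y = a ∧ t y = b) a b)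
    (hG : Group.ResiduallyFinite G)
    (hX : ∀ (x : X) j, 2 ≤ j → HomologyGradientVanishes K (stabilizer G x) j)
    (hY : ∀ (y : Y) j, 1 ≤ j → HomologyGradientVanishes K (stabilizer G y) j) :
    IsKSlowAboveDimOne K G := by
  obtain ⟨X', _, q, hq⟩ := exists_equivariant_equiv_of_finite_orbits (G := G) (X := X)
  obtain ⟨Y', _, r, hr⟩ := exists_equivariant_equiv_of_finite_orbits (G := G) (X := Y)
  have := finite_orbits_of_equivariant_equiv q hq
  have := finite_orbits_of_equivariant_equiv r hr
  have : Nonempty X' := q.nonempty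
  have hq' : ∀ (g : G) x, q.symm (g • x) = g • q.symm x := fun g x => by
    rw [Equiv.symm_apply_eq, hq, Equiv.apply_symm_apply]
  have hstX : ∀ x, stabilizer G x = stabilizer G (q x) := fun x => by
    ext g
    rw [mem_stabilizer_iff, mem_stabilizer_iff, ← hq, q.apply_eq_iff_eq]
  have hstY : ∀ y, stabilizer G y = stabilizer G (r y) := fun y => by
    ext g
    rw [mem_stabilizer_iff, mem_stabilizer_iff, ← hr, r.apply_eq_iff_eq]
  refine isKSlowAboveDimOne_of_action_on_tree (q.symm ∘ s ∘ r) (q.symm ∘ t ∘ r)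
    (fun g y => by simp [hr, hs, hq']) (fun g y => by simp [hr, ht, hq'])
    (edgeBoundary_injective_of_map K s t _ _ q r (by simp) (by simp) r.injective hinj)
    (fun a b => ?_) hG (fun x => ?_) (fun y => ?_)
  · have : ∀ a b, Relation.EqvGen (fun a b => ∃ y, s y = a ∧ t y = b) a b →
        Relation.EqvGen (fun a b => ∃ y, (q.symm ∘ s ∘ r) y = a ∧ (q.symm ∘ t ∘ r) y = b)
          (q.symm a) (q.symm b) := by
      intro a b h
      induction h with
      | rel a b h =>
        obtain ⟨y, rfl, rfl⟩ := h
        exact .rel _ _ ⟨r.symm y, by simp, by simp⟩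
      | refl a => exact .refl _
      | symm a b _ ih => exact .symm _ _ ih
      | trans a b c _ _ h₁ h₂ => exact .trans _ _ _ h₁ h₂
    simpa using this _ _ (hconn (q a) (q b))
  · rw [hstX]
    exact hX _
  · rw [hstY]
    exact hY _

end SmallModel

/-! ### The Bass–Serre forest of the path group. -/

namespace GraphOfGroups

open MulAction

variable {V : Type v} {E : Type w} (𝒢 : GraphOfGroups.{u} V E)

/-- The image of a vertex group in the path group. -/
abbrev vertexSubgroup (x : V) : Subgroup 𝒢.PathGroup := (𝒢.ofVertex x).range

/-- The embedding of an edge group in the path group through its initial vertex. -/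
abbrev ofEdge (e : E) : 𝒢.edgeGroup e →* 𝒢.PathGroup :=
  (𝒢.ofVertex (𝒢.init e)).comp (𝒢.initHom e)

/-- The image of an edge group in the path group. -/
abbrev edgeSubgroup (e : E) : Subgroup 𝒢.PathGroup := (𝒢.ofEdge e).range

/-- The vertices of the Bass–Serre forest on which the path group acts. -/
abbrev ForestVertex : Type (max u v w) := Σ x : V, 𝒢.PathGroup ⧸ 𝒢.vertexSubgroup x

/-- The edges of the Bass–Serre forest on which the path group acts. -/
abbrev ForestEdge : Type (max u v w) := Σ e : E, 𝒢.PathGroup ⧸ 𝒢.edgeSubgroup e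

/-- The initial vertex of an edge of the forest. -/
def forestInit (y : 𝒢.ForestEdge) : 𝒢.ForestVertex :=
  ⟨𝒢.init y.1, Quotient.map' id (fun a b h => by
    rw [QuotientGroup.leftRel_apply] at h ⊢
    obtain ⟨c, hc⟩ := h
    exact ⟨𝒢.initHom y.1 c, hc⟩) y.2⟩

/-- The terminal vertex of an edge of the forest. -/
def forestTerm (y : 𝒢.ForestEdge) : 𝒢.ForestVertex :=
  ⟨𝒢.term y.1, Quotient.map' (· * 𝒢.stable y.1) (fun a b h => by
    rw [QuotientGroup.leftRel_apply] at h ⊢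
    obtain ⟨c, hc⟩ := h
    refine ⟨𝒢.termHom y.1 c, ?_⟩
    -- The relator says that conjugation by `t_e` carries the initial copy of the edge group to the
    -- terminal one.
    rw [← mul_right_inj (𝒢.stable y.1), ← 𝒢.ofVertex_mul_stable]
    change 𝒢.ofEdge y.1 c * _ = _
    rw [hc]
    group) y.2⟩

variable {𝒢}

theorem forestTerm_mk (e : E) (g : 𝒢.PathGroup) :
    𝒢.forestTerm ⟨e, (g : 𝒢.PathGroup ⧸ 𝒢.edgeSubgroup e)⟩ =
      ⟨𝒢.term e, ((g * 𝒢.stable e : 𝒢.PathGroup) : 𝒢.PathGroup ⧸ 𝒢.vertexSubgroup _)⟩ := rfl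

theorem smul_forestVertex_mk (g h : 𝒢.PathGroup) (x : V) :
    g • (⟨x, (h : 𝒢.PathGroup ⧸ 𝒢.vertexSubgroup x)⟩ : 𝒢.ForestVertex) =
      ⟨x, ((g * h : 𝒢.PathGroup) : 𝒢.PathGroup ⧸ 𝒢.vertexSubgroup x)⟩ := rfl

theorem smul_forestEdge_mk (g h : 𝒢.PathGroup) (e : E) :
    g • (⟨e, (h : 𝒢.PathGroup ⧸ 𝒢.edgeSubgroup e)⟩ : 𝒢.ForestEdge) =
      ⟨e, ((g * h : 𝒢.PathGroup) : 𝒢.PathGroup ⧸ 𝒢.edgeSubgroup e)⟩ := rfl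

theorem forestInit_smul (g : 𝒢.PathGroup) (y : 𝒢.ForestEdge) :
    𝒢.forestInit (g • y) = g • 𝒢.forestInit y := by
  obtain ⟨e, c⟩ := y
  induction c using QuotientGroup.induction_on with
  | H h => rfl

theorem forestTerm_smul (g : 𝒢.PathGroup) (y : 𝒢.ForestEdge) :
    𝒢.forestTerm (g • y) = g • 𝒢.forestTerm y := by
  obtain ⟨e, c⟩ := y
  induction c using QuotientGroup.induction_on with
  | H h => rw [smul_forestEdge_mk, forestTerm_mk, forestTerm_mk, smul_forestVertex_mk, mul_assoc]

theorem stabilizer_forestVertex (g h : 𝒢.PathGroup) (x : V) :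
    h • (⟨x, (g : 𝒢.PathGroup ⧸ 𝒢.vertexSubgroup x)⟩ : 𝒢.ForestVertex) = ⟨x, g⟩ ↔
      g⁻¹ * h * g ∈ (𝒢.ofVertex x).range := by
  rw [smul_forestVertex_mk, Sigma.mk.injEq, heq_eq_eq, eq_self_iff_true, true_and, eq_comm,
    QuotientGroup.eq, mul_assoc]

theorem stabilizer_forestEdge (g h : 𝒢.PathGroup) (e : E) :
    h • (⟨e, (g : 𝒢.PathGroup ⧸ 𝒢.edgeSubgroup e)⟩ : 𝒢.ForestEdge) = ⟨e, g⟩ ↔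
      g⁻¹ * h * g ∈ (𝒢.ofEdge e).range := by
  rw [smul_forestEdge_mk, Sigma.mk.injEq, heq_eq_eq, eq_self_iff_true, true_and, eq_comm,
    QuotientGroup.eq, mul_assoc]

section Potential

variable (K : Type*) [Field K]

variable (𝒢) in
/-- The base edge of the forest over `e`. -/
def baseEdge (e : E) : 𝒢.ForestEdge := ⟨e, ((1 : 𝒢.PathGroup) : 𝒢.PathGroup ⧸ 𝒢.edgeSubgroup e)⟩

variable (𝒢) in
open Classical in
/-- The homomorphism to the semidirect product with the functions on the edges of the forest that
is trivial on the vertex groups and maps the generator of an edge to its indicator function. -/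
noncomputable def pathDerivationHom : 𝒢.PathGroup →*
    (𝒢.ForestEdge → Multiplicative K) ⋊[mulAutArrow] 𝒢.PathGroup :=
  𝒢.pathGroupLift (fun x => SemidirectProduct.inr.comp (𝒢.ofVertex x))
    (fun e => ⟨Pi.mulSingle (𝒢.baseEdge e) (Multiplicative.ofAdd 1), 𝒢.stable e⟩) fun e a => by
    ext z
    · have hz : (𝒢.ofVertex _ (𝒢.initHom e a))⁻¹ • z = 𝒢.baseEdge e ↔ z = 𝒢.baseEdge e := by
        rw [inv_smul_eq_iff]
        have : 𝒢.ofVertex _ (𝒢.initHom e a) • 𝒢.baseEdge e = 𝒢.baseEdge e :=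
          (stabilizer_forestEdge 1 _ e).2 ⟨a, by simp⟩
        rw [this]
      have h1 : ∀ y, (Pi.mulSingle (𝒢.baseEdge e) (Multiplicative.ofAdd (1 : K)) :
          𝒢.ForestEdge → Multiplicative K) y =
            if y = 𝒢.baseEdge e then Multiplicative.ofAdd (1 : K) else 1 := fun y =>
        Pi.mulSingle_apply _ _ _
      change (1 : Multiplicative K) * (Pi.mulSingle (𝒢.baseEdge e) (Multiplicative.ofAdd (1 : K)) :
          𝒢.ForestEdge → Multiplicative K) ((𝒢.ofVertex _ (𝒢.initHom e a))⁻¹ • z) =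
        (Pi.mulSingle (𝒢.baseEdge e) (Multiplicative.ofAdd (1 : K)) :
          𝒢.ForestEdge → Multiplicative K) z * 1
      rw [one_mul, mul_one, h1, h1]
      simp only [hz]
    · exact 𝒢.ofVertex_mul_stable e a

/-- The homomorphism is a section of the projection, so its left component is a derivation. -/
theorem pathDerivationHom_right (g : 𝒢.PathGroup) : (𝒢.pathDerivationHom K g).right = g := by
  have : SemidirectProduct.rightHom.comp (𝒢.pathDerivationHom K) = MonoidHom.id 𝒢.PathGroup :=
    pathGroup_hom_ext (fun x g => by simp [pathDerivationHom])
      (fun e => by simp [pathDerivationHom])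
  exact DFunLike.congr_fun this g

variable (𝒢) in
/-- The derivation underlying `pathDerivationHom`. -/
noncomputable def pathDerivation (g : 𝒢.PathGroup) (z : 𝒢.ForestEdge) : K :=
  Multiplicative.toAdd ((𝒢.pathDerivationHom K g).left z)

theorem pathDerivation_mul (g h : 𝒢.PathGroup) (z : 𝒢.ForestEdge) :
    𝒢.pathDerivation K (g * h) z = 𝒢.pathDerivation K g z + 𝒢.pathDerivation K h (g⁻¹ • z) := by
  rw [pathDerivation, map_mul, SemidirectProduct.mul_left, pathDerivationHom_right]
  rfl

theorem pathDerivation_ofVertex (x : V) (g : 𝒢.vertexGroup x) (z : 𝒢.ForestEdge) :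
    𝒢.pathDerivation K (𝒢.ofVertex x g) z = 0 := by
  rw [pathDerivation, pathDerivationHom, pathGroupLift_ofVertex]
  rfl

theorem pathDerivation_stable (e : E) (z : 𝒢.ForestEdge) :
    𝒢.pathDerivation K (𝒢.stable e) z = Finsupp.single (𝒢.baseEdge e) (1 : K) z := by
  classical
  rw [pathDerivation, pathDerivationHom, pathGroupLift_stable, Finsupp.single_apply]
  change Multiplicative.toAdd ((Pi.mulSingle (𝒢.baseEdge e) (Multiplicative.ofAdd (1 : K)) :
    𝒢.ForestEdge → Multiplicative K) z) = _
  rw [Pi.mulSingle_apply]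
  by_cases h : z = 𝒢.baseEdge e
  · simp [h]
  · simp [h, Ne.symm h]

variable (𝒢) in
/-- The potential on the vertices of the forest given by the derivation. -/
noncomputable def forestPotential (p : 𝒢.ForestVertex) : 𝒢.ForestEdge → K :=
  Quotient.liftOn' p.2 (𝒢.pathDerivation K) fun a b h => by
    rw [QuotientGroup.leftRel_apply] at h
    obtain ⟨c, hc⟩ := h
    have hb : b = a * 𝒢.ofVertex p.1 c := by rw [hc, mul_inv_cancel_left]
    ext z
    -- The derivation vanishes on vertex groups, so it is constant on their left cosets.
    rw [hb, pathDerivation_mul, pathDerivation_ofVertex, add_zero]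

/-- For the derivation `δ`, `δ (g t_e) - δ g` is the translate by `g` of `δ t_e`, the indicator of
the edge `g • baseEdge e`. Thus `δ` induces a potential that separates edges. -/
theorem edgeBoundary_forest_injective (K : Type u) [Field K] :
    Function.Injective (edgeBoundary K 𝒢.forestInit 𝒢.forestTerm) := by
  refine edgeBoundary_injective_of_potential K _ _ (𝒢.forestPotential K) fun y => ?_
  obtain ⟨e, c⟩ := y
  induction c using QuotientGroup.induction_on with
  | H g =>
    ext z
    change 𝒢.pathDerivation K (g * 𝒢.stable e) z - 𝒢.pathDerivation K g z = _
    rw [pathDerivation_mul, add_sub_cancel_left, pathDerivation_stable]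
    have : (⟨e, (g : 𝒢.PathGroup ⧸ 𝒢.edgeSubgroup e)⟩ : 𝒢.ForestEdge) = g • 𝒢.baseEdge e := by
      rw [baseEdge, smul_forestEdge_mk, mul_one]
    classical
    rw [this, Finsupp.single_apply, Finsupp.single_apply]
    simp only [eq_inv_smul_iff]

end Potential

end GraphOfGroups

open MulAction in
-- The stabilizer of a coset `g A` is `g A g⁻¹`. By `hπ` this conjugate lies wholly in `π`, so
-- restricting the action to `π` loses nothing.
theorem nonempty_mulEquiv_stabilizer_of_conj {G A F X : Type*} [Group G] [Group A] [Group F]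
    [MulAction G X] {π : Subgroup F} (φ : G ≃* π) (i : A →* F) (hi : Function.Injective i) (g : F)
    (hπ : ∀ a, g * i a * g⁻¹ ∈ π) (x : X)
    (hx : ∀ h : G, h • x = x ↔ g⁻¹ * (φ h : F) * g ∈ i.range) :
    Nonempty (A ≃* stabilizer G x) := by
  let f : A →* stabilizer G x :=
    { toFun := fun a => ⟨φ.symm ⟨g * i a * g⁻¹, hπ a⟩, by
        rw [mem_stabilizer_iff, hx, MulEquiv.apply_symm_apply]
        exact ⟨a, by group⟩⟩
      map_one' := by
        apply Subtype.ext
        apply φ.injective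
        ext
        simp
      map_mul' := fun a b => by
        apply Subtype.ext
        apply φ.injective
        ext
        simp }
  refine ⟨MulEquiv.ofBijective f ⟨fun a b h => hi ?_, fun h => ?_⟩⟩
  · have := congrArg Subtype.val (φ.symm.injective (congrArg Subtype.val h))
    simpa using this
  · obtain ⟨a, ha⟩ := (hx h.1).1 h.2
    refine ⟨a, Subtype.ext (φ.injective (Subtype.ext ?_))⟩
    simp [f, ha, mul_assoc]

/-! ### The Bass–Serre tree: cosets in the forest represented by paths from `x₀`. -/

namespace GraphOfGroups

open MulAction

variable {V : Type v} {E : Type w} (𝒢 : GraphOfGroups.{u} V E) (x₀ : V)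

/-- The vertices of the Bass–Serre tree. -/
def TreeVertex : Type (max u v w) :=
  {p : 𝒢.ForestVertex // ∃ g, 𝒢.IsPathElement x₀ p.1 g ∧ p.2 = g}

instance : MulAction (𝒢.fundamentalGroup x₀) (𝒢.TreeVertex x₀) where
  smul h p := ⟨(h : 𝒢.PathGroup) • p.1, by
    obtain ⟨⟨x, c⟩, g, hg, hp⟩ := p
    exact ⟨h * g, .mul h.2 hg, congrArg ((h : 𝒢.PathGroup) • ·) hp⟩⟩
  one_smul p := Subtype.ext (one_smul 𝒢.PathGroup p.1)
  mul_smul g h p := Subtype.ext (mul_smul (g : 𝒢.PathGroup) h p.1)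

/-- The edges of the Bass–Serre tree. -/
def TreeEdge : Type (max u v w) :=
  {p : 𝒢.ForestEdge // ∃ g, 𝒢.IsPathElement x₀ (𝒢.init p.1) g ∧ p.2 = g}

instance : MulAction (𝒢.fundamentalGroup x₀) (𝒢.TreeEdge x₀) where
  smul h p := ⟨(h : 𝒢.PathGroup) • p.1, by
    obtain ⟨⟨x, c⟩, g, hg, hp⟩ := p
    exact ⟨h * g, .mul h.2 hg, congrArg ((h : 𝒢.PathGroup) • ·) hp⟩⟩
  one_smul p := Subtype.ext (one_smul 𝒢.PathGroup p.1)
  mul_smul g h p := Subtype.ext (mul_smul (g : 𝒢.PathGroup) h p.1)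

variable {𝒢 x₀}

/-- The vertex of the Bass–Serre tree at the end of a path. -/
def treeVertexMk {x : V} {g : 𝒢.PathGroup} (hg : 𝒢.IsPathElement x₀ x g) : 𝒢.TreeVertex x₀ :=
  ⟨⟨x, g⟩, g, hg, rfl⟩

/-- The edge of the Bass–Serre tree at the end of a path. -/
def treeEdgeMk {e : E} {g : 𝒢.PathGroup} (hg : 𝒢.IsPathElement x₀ (𝒢.init e) g) :
    𝒢.TreeEdge x₀ :=
  ⟨⟨e, g⟩, g, hg, rfl⟩

theorem exists_eq_treeVertexMk (p : 𝒢.TreeVertex x₀) :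
    ∃ (x : V) (g : 𝒢.PathGroup) (hg : 𝒢.IsPathElement x₀ x g), p = treeVertexMk hg := by
  obtain ⟨⟨x, c⟩, g, hg, h⟩ := p
  obtain rfl : c = g := h
  exact ⟨x, g, hg, rfl⟩

theorem exists_eq_treeEdgeMk (p : 𝒢.TreeEdge x₀) :
    ∃ (e : E) (g : 𝒢.PathGroup) (hg : 𝒢.IsPathElement x₀ (𝒢.init e) g), p = treeEdgeMk hg := by
  obtain ⟨⟨x, c⟩, g, hg, h⟩ := p
  obtain rfl : c = g := h
  exact ⟨x, g, hg, rfl⟩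

theorem treeVertexMk_congr {x : V} {g h : 𝒢.PathGroup} (hg : 𝒢.IsPathElement x₀ x g)
    (hh : 𝒢.IsPathElement x₀ x h) (e : g⁻¹ * h ∈ 𝒢.vertexSubgroup x) :
    treeVertexMk hg = treeVertexMk hh := by
  apply Subtype.ext
  change (⟨x, _⟩ : 𝒢.ForestVertex) = ⟨x, _⟩
  rw [QuotientGroup.eq.2 e]

variable (𝒢 x₀) in
/-- The initial vertex of an edge of the Bass–Serre tree. -/
def treeInit (y : 𝒢.TreeEdge x₀) : 𝒢.TreeVertex x₀ :=
  ⟨𝒢.forestInit y.1, by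
    obtain ⟨e, g, hg, rfl⟩ := exists_eq_treeEdgeMk y
    exact ⟨g, hg, rfl⟩⟩

variable (𝒢 x₀) in
/-- The terminal vertex of an edge of the Bass–Serre tree. -/
def treeTerm (y : 𝒢.TreeEdge x₀) : 𝒢.TreeVertex x₀ :=
  ⟨𝒢.forestTerm y.1, by
    obtain ⟨e, g, hg, rfl⟩ := exists_eq_treeEdgeMk y
    exact ⟨g * 𝒢.stable e, .mul hg (.edge e), rfl⟩⟩

/-- A path element is read letter by letter: vertex letters do not change the coset, and edge
letters cross one edge. -/
theorem eqvGen_treeVertexMk_mul {x y : V} {p : 𝒢.PathGroup} (hp : 𝒢.IsPathElement x y p) :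
    ∀ {g : 𝒢.PathGroup} (hg : 𝒢.IsPathElement x₀ x g),
      Relation.EqvGen (fun a b => ∃ z, 𝒢.treeInit x₀ z = a ∧ 𝒢.treeTerm x₀ z = b)
        (treeVertexMk hg) (treeVertexMk (hg.mul hp)) := by
  induction hp with
  | vertex x a =>
    intro g hg
    rw [treeVertexMk_congr hg (hg.mul (.vertex x a)) ⟨a, by group⟩]
    exact .refl _
  | edge e =>
    intro g hg
    exact .rel _ _ ⟨treeEdgeMk hg, rfl, rfl⟩
  | edgeInv e =>
    intro g hg
    -- The edge based at `g t_e⁻¹` ends at `g`, and is crossed backwards.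
    refine .symm _ _ (.rel _ _ ⟨treeEdgeMk (hg.mul (.edgeInv e)), rfl, ?_⟩)
    exact treeVertexMk_congr ((hg.mul (.edgeInv e)).mul (.edge e)) hg (by simp)
  | mul hp hq ihp ihq =>
    intro g hg
    refine .trans _ _ _ (ihp hg) ?_
    rw [treeVertexMk_congr (hg.mul (hp.mul hq)) ((hg.mul hp).mul hq) (by simp [mul_assoc])]
    exact ihq _

theorem isPathElement_one : 𝒢.IsPathElement x₀ x₀ 1 := (𝒢.fundamentalGroup x₀).one_mem

theorem eqvGen_treeVertex (a b : 𝒢.TreeVertex x₀) :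
    Relation.EqvGen (fun a b => ∃ z, 𝒢.treeInit x₀ z = a ∧ 𝒢.treeTerm x₀ z = b) a b := by
  have key : ∀ a, Relation.EqvGen
      (fun a b => ∃ z, 𝒢.treeInit x₀ z = a ∧ 𝒢.treeTerm x₀ z = b)
        (treeVertexMk isPathElement_one) a := by
    intro a
    obtain ⟨x, g, hg, rfl⟩ := exists_eq_treeVertexMk a
    rw [treeVertexMk_congr hg (isPathElement_one.mul hg) (by simp)]
    exact eqvGen_treeVertexMk_mul hg _
  exact .trans _ _ _ (.symm _ _ (key a)) (key b)

theorem edgeBoundary_tree_injective (K : Type u) [Field K] :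
    Function.Injective (edgeBoundary K (𝒢.treeInit x₀) (𝒢.treeTerm x₀)) :=
  edgeBoundary_injective_of_map K 𝒢.forestInit 𝒢.forestTerm _ _ Subtype.val Subtype.val
    (fun _ => rfl) (fun _ => rfl) Subtype.val_injective (edgeBoundary_forest_injective K)

section Action

variable {G : Type*} [Group G] (φ : G ≃* 𝒢.fundamentalGroup x₀)

/-- The action of a group isomorphic to the fundamental group on the vertices of the tree. -/
abbrev treeVertexAction : MulAction G (𝒢.TreeVertex x₀) := MulAction.compHom _ φ.toMonoidHom

/-- The action of a group isomorphic to the fundamental group on the edges of the tree. -/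
abbrev treeEdgeAction : MulAction G (𝒢.TreeEdge x₀) := MulAction.compHom _ φ.toMonoidHom

/-- Two paths `g`, `k` from `x₀` to the same vertex differ by the closed path `g k⁻¹`, so orbits
inject into `V`. -/
theorem finite_treeVertex_orbits [Finite V] :
    letI := treeVertexAction φ
    Finite (orbitRel.Quotient G (𝒢.TreeVertex x₀)) := by
  let _ := treeVertexAction φ
  refine Finite.of_injective (β := V) (fun ω => ω.out.1.1) fun a b h => ?_
  rw [← a.out_eq', ← b.out_eq']
  obtain ⟨x, g, hg, ha⟩ := exists_eq_treeVertexMk a.out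
  obtain ⟨y, k, hk, hb⟩ := exists_eq_treeVertexMk b.out
  simp only [ha, hb] at h
  obtain rfl : x = y := h
  rw [ha, hb]
  refine Quotient.sound' ⟨φ.symm ⟨g * k⁻¹, hg.mul hk.inv⟩, ?_⟩
  change φ (φ.symm _) • treeVertexMk hk = treeVertexMk hg
  rw [φ.apply_symm_apply]
  exact treeVertexMk_congr ((hg.mul hk.inv).mul hk) hg (by simp)

theorem finite_treeEdge_orbits [Finite E] :
    letI := treeEdgeAction φ
    Finite (orbitRel.Quotient G (𝒢.TreeEdge x₀)) := by
  let _ := treeEdgeAction φ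
  refine Finite.of_injective (β := E) (fun ω => ω.out.1.1) fun a b h => ?_
  rw [← a.out_eq', ← b.out_eq']
  obtain ⟨x, g, hg, ha⟩ := exists_eq_treeEdgeMk a.out
  obtain ⟨y, k, hk, hb⟩ := exists_eq_treeEdgeMk b.out
  simp only [ha, hb] at h
  obtain rfl : x = y := h
  rw [ha, hb]
  refine Quotient.sound' ⟨φ.symm ⟨g * k⁻¹, hg.mul hk.inv⟩, ?_⟩
  change φ (φ.symm _) • treeEdgeMk hk = treeEdgeMk hg
  rw [φ.apply_symm_apply]
  apply Subtype.ext
  change (⟨x, ((g * k⁻¹ * k : 𝒢.PathGroup) : 𝒢.PathGroup ⧸ 𝒢.edgeSubgroup x)⟩ : 𝒢.ForestEdge) =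
    ⟨x, g⟩
  rw [inv_mul_cancel_right]

theorem exists_mulEquiv_stabilizer_treeVertex (p : 𝒢.TreeVertex x₀) :
    letI := treeVertexAction φ
    ∃ x, Nonempty (𝒢.vertexGroup x ≃* stabilizer G p) := by
  let _ := treeVertexAction φ
  obtain ⟨x, g, hg, rfl⟩ := exists_eq_treeVertexMk p
  refine ⟨x, nonempty_mulEquiv_stabilizer_of_conj φ (𝒢.ofVertex x) (𝒢.ofVertex_injective x) g
    (fun a => (hg.mul (.vertex x a)).mul hg.inv) _ fun h => ?_⟩
  rw [← stabilizer_forestVertex]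
  exact Subtype.ext_iff

theorem exists_mulEquiv_stabilizer_treeEdge (p : 𝒢.TreeEdge x₀) :
    letI := treeEdgeAction φ
    ∃ e, Nonempty (𝒢.edgeGroup e ≃* stabilizer G p) := by
  let _ := treeEdgeAction φ
  obtain ⟨e, g, hg, rfl⟩ := exists_eq_treeEdgeMk p
  refine ⟨e, nonempty_mulEquiv_stabilizer_of_conj φ (𝒢.ofEdge e)
    ((𝒢.ofVertex_injective _).comp (𝒢.initHom_injective e)) g
    (fun a => (hg.mul (.vertex _ (𝒢.initHom e a))).mul hg.inv) _ fun h => ?_⟩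
  rw [← stabilizer_forestEdge]
  exact Subtype.ext_iff

end Action

end GraphOfGroups


/-! ### The proposition. -/

theorem mainTheorem8 {K : Type u} [Field K] {V : Type v} {E : Type w} [Finite V] [Finite E]
    (𝒢 : GraphOfGroups.{u} V E) (x₀ : V)
    {G : Type u} [Group G] [Group.ResiduallyFinite G]
    (φ : G ≃* 𝒢.fundamentalGroup x₀)
    (hE : ∀ e : E, IsKSlow K (𝒢.edgeGroup e))
    (hV : ∀ x : V, IsKSlowAboveDimOne K (𝒢.vertexGroup x)) :
    IsKSlowAboveDimOne K G := by
  
  let _ := GraphOfGroups.treeVertexAction φ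
  let _ := GraphOfGroups.treeEdgeAction φ
  have := GraphOfGroups.finite_treeVertex_orbits φ
  have := GraphOfGroups.finite_treeEdge_orbits φ
  have : Nonempty (𝒢.TreeVertex x₀) := ⟨GraphOfGroups.treeVertexMk GraphOfGroups.isPathElement_one⟩
  refine isKSlowAboveDimOne_of_action_on_large_tree (𝒢.treeInit x₀) (𝒢.treeTerm x₀)
    (fun g y => Subtype.ext (GraphOfGroups.forestInit_smul (φ g).1 y.1))
    (fun g y => Subtype.ext (GraphOfGroups.forestTerm_smul (φ g).1 y.1))
    (GraphOfGroups.edgeBoundary_tree_injective K) GraphOfGroups.eqvGen_treeVertex inferInstance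
    (fun p j hj => ?_) (fun p j hj => ?_)
  · obtain ⟨x, ⟨e⟩⟩ := GraphOfGroups.exists_mulEquiv_stabilizer_treeVertex φ p
    exact ((hV x).vanishes j hj).of_mulEquiv e
  · obtain ⟨x, ⟨e⟩⟩ := GraphOfGroups.exists_mulEquiv_stabilizer_treeEdge φ p
    obtain rfl | hj := hj.eq_or_lt
    · exact (hE x).vanishes_one.of_mulEquiv e
    · exact ((hE x).vanishes j hj).of_mulEquiv e
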